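/- Consider the planar Stark problem $$\ddot x=-\frac{x}{r^3}+1,\qquad \ddot y=-\frac{y}{r^3},\qquad r=\sqrt{x^2+y^2}.$$ A brake orbit is a periodic solution whose velocity vanishes at some time; a collision orbit is a solution that tends to the origin as $t$ tends to some finite time. For every $a'\in(-1,1)$ there exist $k_b\in\mathbb N$ and two sequences of positive numbers $(d_k)_{k\ge k_b}$ and $(d'_k)_{k\ge k_b}$ with the following properties. (i) For every $k\ge k_b$, the solution $A'_k$ with initial position $(x(0),y(0))=(a',d_k)$ and zero initial velocity is a brake orbit which, in the time after $0$, intersects the positive $x$-axis exactly $k$ times before it first reaches the negative $x$-axis, and there it intersects the negative $x$-axis perpendicularly. (ii) For every $k\ge k_b$, the solution $B'_k$ with initial position $(x(0),y(0))=(a',d'_k)$ and zero initial velocity is a collision orbit which intersects the positive $x$-axis exactly $k$ times between time $0$ and the collision. (iii) $\lim_{k\to\infty}d_k=\lim_{k\to\infty}d'_k=\sqrt{1-a'^2}$. (iv) $d_k<d'_k<d_{k+1}$ for all $k\ge k_b$. Moreover $k_b\to+\infty$ as $a'\to1^-$, in the sense that this holds for every choice, for each $a'\in(-1,1)$, of an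 index $k_b=k_b(a')$ for which such sequences exist (in particular for the smallest one). -/

import Mathlib

open Set Filter Topology

/-- `(x, y)` with velocity `(u, v)` is a collision-free solution, at every time of `I`, of the planar
Stark problem `x'' = -x / r ^ 3 + 1`, `y'' = -y / r ^ 3`, where `r = √(x ^ 2 + y ^ 2)`.
(`I` is an open set of times below, so two-sided derivatives are the right ones.) -/
structure IsStarkSolutionOn (x y u v : ℝ → ℝ) (I : Set ℝ) : Prop where
  ne_zero : ∀ t ∈ I, x t ≠ 0 ∨ y t ≠ 0
  deriv_x : ∀ t ∈ I, HasDerivAt x (u t) t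
  deriv_y : ∀ t ∈ I, HasDerivAt y (v t) t
  deriv_u : ∀ t ∈ I, HasDerivAt u (-(x t / Real.sqrt (x t ^ 2 + y t ^ 2) ^ 3) + 1) t
  deriv_v : ∀ t ∈ I, HasDerivAt v (-(y t / Real.sqrt (x t ^ 2 + y t ^ 2) ^ 3)) t

/-- At time `0` the particle is at rest at the point `(a, d)`. -/
structure StartsAtRest (x y u v : ℝ → ℝ) (a d : ℝ) : Prop where
  x_zero : x 0 = a
  y_zero : y 0 = d
  u_zero : u 0 = 0
  v_zero : v 0 = 0

/-- A brake orbit: a periodic solution whose velocity vanishes at some time. -/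
structure IsBrakeOrbit (x y u v : ℝ → ℝ) : Prop where
  solution : IsStarkSolutionOn x y u v univ
  periodic : ∃ P : ℝ, 0 < P ∧ Function.Periodic x P ∧ Function.Periodic y P
  brake : ∃ t : ℝ, u t = 0 ∧ v t = 0

/-- The times strictly between `0` and `T` at which the orbit is on the positive `x`-axis. -/
def positiveAxisTimes (x y : ℝ → ℝ) (T : ℝ) : Set ℝ :=
  {t | t ∈ Ioo 0 T ∧ y t = 0 ∧ 0 < x t}

/-- At time `T` the orbit intersects the negative `x`-axis perpendicularly. -/
def HitsNegativeAxisPerpendicularly (x y u v : ℝ → ℝ) (T : ℝ) : Prop :=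
  y T = 0 ∧ x T < 0 ∧ u T = 0 ∧ v T ≠ 0

/-- The orbit starting at rest at `(a, d)` is a brake orbit which, after the time `0`, intersects the
positive `x`-axis exactly `k` times before its first arrival (at time `T`) on the negative
`x`-axis, where it is perpendicular to that axis. -/
def IsTypeA (a d : ℝ) (k : ℕ) : Prop :=
  ∃ x y u v : ℝ → ℝ, StartsAtRest x y u v a d ∧ IsBrakeOrbit x y u v ∧
    ∃ T : ℝ, 0 < T ∧ HitsNegativeAxisPerpendicularly x y u v T ∧
      (∀ t ∈ Ioo 0 T, y t = 0 → 0 < x t) ∧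
      (positiveAxisTimes x y T).encard = (k : ℕ∞)

/-- The orbit starting at rest at `(a, d)` collides with the origin at a time `T > 0`, and it
intersects the positive `x`-axis exactly `k` times between the time `0` and the collision. -/
def IsTypeB (a d : ℝ) (k : ℕ) : Prop :=
  ∃ x y u v : ℝ → ℝ, StartsAtRest x y u v a d ∧
    ∃ S T : ℝ, S < 0 ∧ 0 < T ∧ IsStarkSolutionOn x y u v (Ioo S T) ∧
      Tendsto x (𝓝[<] T) (𝓝 0) ∧ Tendsto y (𝓝[<] T) (𝓝 0) ∧
      (positiveAxisTimes x y T).encard = (k : ℕ∞)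

/-- The number `kb` is an admissible first index for the abscissa `a`: there are sequences
`d k`, `d' k` (for `k ≥ kb`) with all the required properties. -/
def IsAdmissibleIndex (a : ℝ) (kb : ℕ) : Prop :=
  ∃ d d' : ℕ → ℝ,
    (∀ k : ℕ, kb ≤ k → 0 < d k ∧ IsTypeA a (d k) k) ∧
    (∀ k : ℕ, kb ≤ k → 0 < d' k ∧ IsTypeB a (d' k) k) ∧
    Tendsto d atTop (𝓝 (Real.sqrt (1 - a ^ 2))) ∧
    Tendsto d' atTop (𝓝 (Real.sqrt (1 - a ^ 2))) ∧
    (∀ k : ℕ, kb ≤ k → d k < d' k ∧ d' k < d (k + 1))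

/-!
In parabolic coordinates `x + i y = (ξ + i η) ^ 2 / 2` and the time `s` with
`dt = (ξ ^ 2 + η ^ 2) ds` (Levi-Civita regularization) the Stark problem separates into two Duffing
equations. An orbit starting at rest corresponds to `ξ = √m cos θ`, `η = √n cos φ`, where both
phases start at `0` and increase; it first reaches `ξ = 0`, the closed negative `x`-axis, after a
quarter period of `ξ`, and before that it crosses the positive `x`-axis at the zeros of `η`. If the
ratio of the quarter periods of `ξ` and `η` is `2 k`, then `η` is extremal at that moment, so the
orbit is a brake orbit meeting the axis perpendicularly; if the ratio is `2 k + 1`, then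
`ξ = η = 0`, a collision.

For a fixed abscissa `a` the ratio is a continuous function of the initial distance `r` to the
origin, and tends to infinity as `r → 1`, where the starting point of `ξ` tends to an unstable
equilibrium of its Duffing equation. The last radii at which the ratio equals `2 k` and `2 k + 1`
give the two sequences.

As `a → 1` the starting points `(a, d)` with `d ≤ √(1 - a ^ 2)` tend to the equilibrium `(1, 0)`.
The orbit then stays near it for a long time, where `y'' = -y / r ^ 3` is close to `y'' = -y`, and
Sturm comparison forces many crossings of the positive `x`-axis.
-/

open Real

section Primitive

variable {p q : ℝ → ℝ} {P : ℝ}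

/-- The primitive of `p` vanishing at `0`. The autonomous equation `g' = 1 / p g` is solved by its
inverse function. -/
noncomputable def primitive (p : ℝ → ℝ) (s : ℝ) : ℝ := ∫ w in (0 : ℝ)..s, p w

@[simp]
lemma primitive_zero (p : ℝ → ℝ) : primitive p 0 = 0 := intervalIntegral.integral_same

lemma hasDerivAt_primitive (hp : Continuous p) (s : ℝ) : HasDerivAt (primitive p) (p s) s :=
  (hp.integral_hasStrictDerivAt 0 s).hasDerivAt

lemma continuous_primitive (hp : Continuous p) : Continuous (primitive p) :=
  continuous_iff_continuousAt.2 fun s => (hasDerivAt_primitive hp s).continuousAt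

lemma primitive_sub_primitive (hp : Continuous p) (a b : ℝ) :
    primitive p b - primitive p a = ∫ w in a..b, p w :=
  intervalIntegral.integral_interval_sub_left (hp.intervalIntegrable _ _)
    (hp.intervalIntegrable _ _)

lemma primitive_neg (heven : Function.Even p) (s : ℝ) : primitive p (-s) = -primitive p s := by
  have h := intervalIntegral.integral_comp_neg (a := 0) (b := s) p
  simp only [heven _, neg_zero] at h
  rw [primitive, primitive, h, intervalIntegral.integral_symm]

lemma primitive_add_int_mul (hp : Continuous p) (hper : Function.Periodic p P) (m : ℤ) (s : ℝ) :
    primitive p (s + m * P) = primitive p s + m * primitive p P := by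
  have h := hper.intervalIntegral_add_zsmul_eq m s fun _ _ => hp.intervalIntegrable _ _
  rw [zsmul_eq_mul, zsmul_eq_mul, hper.intervalIntegral_add_eq s 0, zero_add] at h
  rw [← sub_eq_iff_eq_add', primitive_sub_primitive hp, h, primitive]

lemma primitive_int_mul_half (hp : Continuous p) (hper : Function.Periodic p P)
    (heven : Function.Even p) (m : ℤ) :
    primitive p (m * (P / 2)) = m * primitive p (P / 2) := by
  have hP : primitive p P = 2 * primitive p (P / 2) := by
    have h := primitive_add_int_mul hp hper 1 (-(P / 2))
    rw [primitive_neg heven] at h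
    norm_num at h
    rw [show -(P / 2) + P = P / 2 by ring] at h
    linarith
  obtain ⟨j, rfl | rfl⟩ := Int.even_or_odd' m
  · have h := primitive_add_int_mul hp hper j 0
    rw [zero_add, primitive_zero, hP] at h
    push_cast
    rw [show 2 * (j : ℝ) * (P / 2) = j * P by ring, h]
    ring
  · have h := primitive_add_int_mul hp hper j (P / 2)
    rw [hP] at h
    push_cast
    rw [show (2 * (j : ℝ) + 1) * (P / 2) = P / 2 + j * P by ring, h]
    ring

lemma strictMono_primitive (hp : Continuous p) (hnonneg : ∀ s, 0 ≤ p s)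
    (hdense : Dense {s | p s ≠ 0}) : StrictMono (primitive p) := fun a b hab => by
  obtain ⟨c, hc, hpc⟩ := hdense.exists_between hab
  rw [← sub_pos, primitive_sub_primitive hp]
  exact intervalIntegral.integral_pos hab hp.continuousOn (fun s _ => hnonneg s)
    ⟨c, Ioo_subset_Icc_self hpc, (hnonneg c).lt_of_ne' hc⟩

lemma surjective_primitive_of_periodic_le (hp : Continuous p) (hq : Continuous q)
    (hle : ∀ s, q s ≤ p s) (hP : 0 < P) (hper : Function.Periodic q P)
    (hpos : 0 < primitive q P) : Function.Surjective (primitive p) := by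
  refine (continuous_primitive hp).surjective
    (tendsto_atTop_mono' _ ?_ (hper.tendsto_atTop_intervalIntegral_of_pos hpos hP))
    (tendsto_atBot_mono' _ ?_ (hper.tendsto_atBot_intervalIntegral_of_pos hpos hP))
  · filter_upwards [eventually_ge_atTop 0] with s hs
    exact intervalIntegral.integral_mono_on hs (hq.intervalIntegrable _ _)
      (hp.intervalIntegrable _ _) fun w _ => hle w
  · filter_upwards [eventually_le_atBot 0] with s hs
    rw [primitive, intervalIntegral.integral_symm s, intervalIntegral.integral_symm s]
    exact neg_le_neg (intervalIntegral.integral_mono_on hs (hq.intervalIntegrable _ _)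
      (hp.intervalIntegrable _ _) fun w _ => hle w)

end Primitive

section Phase

variable {f : ℝ → ℝ}

/-- A right-hand side `f` for the equation `θ' = f θ` of an increasing phase `θ` whose symmetries
are those of the square of a harmonic oscillation `cos θ`. -/
structure IsPhaseSpeed (f : ℝ → ℝ) : Prop where
  continuous : Continuous f
  pos : ∀ w, 0 < f w
  periodic : Function.Periodic f π
  even : Function.Even f

/-- The time that a phase moving with speed `f` needs from `0` to `π / 2`. -/
noncomputable def quarterPeriod (f : ℝ → ℝ) : ℝ := primitive (fun w => (f w)⁻¹) (π / 2)

namespace IsPhaseSpeed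

variable (hf : IsPhaseSpeed f)
include hf

lemma continuous_inv : Continuous fun w => (f w)⁻¹ := hf.continuous.inv₀ fun w => (hf.pos w).ne'

lemma periodic_inv : Function.Periodic (fun w => (f w)⁻¹) π := hf.periodic.comp _

lemma even_inv : Function.Even fun w => (f w)⁻¹ := hf.even.left_comp _

lemma strictMono_primitive_inv : StrictMono (primitive fun w => (f w)⁻¹) :=
  strictMono_primitive hf.continuous_inv (fun w => (inv_pos.2 (hf.pos w)).le)
    (by simp [(hf.pos _).ne'])

lemma surjective_primitive_inv : Function.Surjective (primitive fun w => (f w)⁻¹) :=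
  surjective_primitive_of_periodic_le hf.continuous_inv hf.continuous_inv (fun _ => le_rfl) pi_pos
    hf.periodic_inv (by simpa using hf.strictMono_primitive_inv pi_pos)

/-- The solution of `θ' = f θ`, `θ 0 = 0`, as an order automorphism of the line. -/
noncomputable def phase : ℝ ≃o ℝ :=
  (hf.strictMono_primitive_inv.orderIsoOfSurjective _ hf.surjective_primitive_inv).symm

lemma phase_symm_apply (w : ℝ) : hf.phase.symm w = primitive (fun w => (f w)⁻¹) w := rfl

lemma hasDerivAt_phase (s : ℝ) : HasDerivAt hf.phase (f (hf.phase s)) s := by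
  simpa using HasDerivAt.of_local_left_inverse hf.phase.continuous.continuousAt
    (hasDerivAt_primitive hf.continuous_inv _) (inv_ne_zero (hf.pos _).ne')
    (.of_forall hf.phase.symm_apply_apply)

lemma quarterPeriod_pos : 0 < quarterPeriod f := by
  simpa [quarterPeriod] using hf.strictMono_primitive_inv pi_div_two_pos

lemma phase_int_mul_quarterPeriod (m : ℤ) : hf.phase (m * quarterPeriod f) = m * (π / 2) := by
  rw [← OrderIso.eq_symm_apply, phase_symm_apply,
    primitive_int_mul_half hf.continuous_inv hf.periodic_inv hf.even_inv, quarterPeriod]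

lemma phase_quarterPeriod : hf.phase (quarterPeriod f) = π / 2 := by
  simpa using hf.phase_int_mul_quarterPeriod 1

@[simp]
lemma phase_zero : hf.phase 0 = 0 := by simpa using hf.phase_int_mul_quarterPeriod 0

lemma phase_add_int_mul (m : ℤ) (s : ℝ) :
    hf.phase (s + m * (2 * quarterPeriod f)) = hf.phase s + m * π := by
  have h := primitive_int_mul_half hf.continuous_inv hf.periodic_inv hf.even_inv 2
  rw [Int.cast_ofNat, mul_div_cancel₀ _ two_ne_zero] at h
  rw [← OrderIso.eq_symm_apply, phase_symm_apply,
    primitive_add_int_mul hf.continuous_inv hf.periodic_inv, h, ← phase_symm_apply hf,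
    OrderIso.symm_apply_apply, quarterPeriod]

end IsPhaseSpeed

end Phase

section Duffing

variable {h κ m : ℝ} {ζ ω : ℝ → ℝ}

/-- `ζ`, with velocity `ω`, solves the Duffing equation `ζ'' = 2 h ζ + 2 κ ζ ^ 3`, and its energy is
that of a solution which is at rest when `ζ ^ 2 = m`. -/
structure IsDuffingSolution (h κ m : ℝ) (ζ ω : ℝ → ℝ) : Prop where
  deriv : ∀ s, HasDerivAt ζ (ω s) s
  deriv_velocity : ∀ s, HasDerivAt ω (2 * h * ζ s + 2 * κ * ζ s ^ 3) s
  energy : ∀ s, ω s ^ 2 = 2 * h * (ζ s ^ 2 - m) + κ * (ζ s ^ 4 - m ^ 2)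

lemma IsDuffingSolution.continuous (hζ : IsDuffingSolution h κ m ζ ω) : Continuous ζ :=
  continuous_iff_continuousAt.2 fun s => (hζ.deriv s).continuousAt

/-- The speed of the phase `θ` of the solution `√m cos θ` of the Duffing equation, obtained by
solving its energy equation for `θ'`. -/
noncomputable def duffingSpeed (h κ m θ : ℝ) : ℝ := √(-(2 * h + κ * m * (1 + cos θ ^ 2)))

lemma isPhaseSpeed_duffingSpeed (hh : h < 0) (hκ : h + κ * m < 0) :
    IsPhaseSpeed (duffingSpeed h κ m) where
  continuous := by unfold duffingSpeed; fun_prop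
  -- The radicand is a convex combination of its values at `cos θ ^ 2 = 0` and `cos θ ^ 2 = 1`.
  pos θ := sqrt_pos.2 (by nlinarith [sq_nonneg (cos θ), cos_sq_le_one θ])
  periodic θ := by simp [duffingSpeed]
  even θ := by simp [duffingSpeed]

variable (hf : IsPhaseSpeed (duffingSpeed h κ m))

include hf in
lemma IsPhaseSpeed.duffingSpeed_sq (θ : ℝ) :
    duffingSpeed h κ m θ ^ 2 = -(2 * h + κ * m * (1 + cos θ ^ 2)) :=
  sq_sqrt (sqrt_pos.1 (hf.pos θ)).le

lemma IsPhaseSpeed.hasDerivAt_duffingSpeed_phase (s : ℝ) :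
    HasDerivAt (fun s => duffingSpeed h κ m (hf.phase s))
      (κ * m * sin (hf.phase s) * cos (hf.phase s)) s := by
  have hpos := hf.pos (hf.phase s)
  refine (((((((hf.hasDerivAt_phase s).cos.pow 2).const_add 1).const_mul (κ * m)).const_add
    (2 * h)).neg).sqrt (sqrt_pos.1 hpos).ne').congr_deriv ?_
  change _ / (2 * duffingSpeed h κ m (hf.phase s)) = _
  field_simp
  push_cast
  ring

/-- The solution of the Duffing equation that is at rest at `√m` at time `0`. -/
noncomputable def duffingPosition (hf : IsPhaseSpeed (duffingSpeed h κ m)) (s : ℝ) : ℝ :=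
  √m * cos (hf.phase s)

/-- The velocity of `duffingPosition`. -/
noncomputable def duffingVelocity (hf : IsPhaseSpeed (duffingSpeed h κ m)) (s : ℝ) : ℝ :=
  -(√m * sin (hf.phase s) * duffingSpeed h κ m (hf.phase s))

theorem isDuffingSolution_duffingPosition (hm : 0 ≤ m) :
    IsDuffingSolution h κ m (duffingPosition hf) (duffingVelocity hf) where
  deriv s := ((hf.hasDerivAt_phase s).cos.const_mul √m).congr_deriv <| by
    rw [duffingVelocity]; ring
  deriv_velocity s := by
    refine (((hf.hasDerivAt_phase s).sin.const_mul √m).mul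
      (hf.hasDerivAt_duffingSpeed_phase s)).neg.congr_deriv ?_
    rw [duffingPosition]
    linear_combination -(√m * cos (hf.phase s)) * hf.duffingSpeed_sq (hf.phase s) -
      √m * cos (hf.phase s) * κ * m * sin_sq_add_cos_sq (hf.phase s) -
      2 * κ * √m * cos (hf.phase s) ^ 3 * sq_sqrt hm
  energy s := by
    have hm4 : √m ^ 4 = m ^ 2 := by rw [← sq_sqrt hm, ← pow_mul, sq_sqrt hm]
    rw [duffingPosition, duffingVelocity, neg_sq, mul_pow, mul_pow, mul_pow, mul_pow, hm4,
      sq_sqrt hm, hf.duffingSpeed_sq, sin_sq]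
    ring

lemma duffingPosition_zero : duffingPosition hf 0 = √m := by simp [duffingPosition]

lemma duffingVelocity_zero : duffingVelocity hf 0 = 0 := by simp [duffingVelocity]

lemma duffingPosition_eq_zero_iff (hm : 0 < m) {s : ℝ} :
    duffingPosition hf s = 0 ↔ cos (hf.phase s) = 0 := by
  simp [duffingPosition, (sqrt_pos.2 hm).ne']

lemma periodic_duffingPosition :
    Function.Periodic (duffingPosition hf) (4 * quarterPeriod (duffingSpeed h κ m)) := fun s => by
  have hphase := hf.phase_add_int_mul 2 s
  rw [Int.cast_ofNat, ← mul_assoc] at hphase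
  norm_num only at hphase
  rw [duffingPosition, hphase, cos_add_two_pi, duffingPosition]

lemma duffingPosition_pos (hm : 0 < m) {s : ℝ}
    (hs : s ∈ Ioo (-quarterPeriod (duffingSpeed h κ m)) (quarterPeriod (duffingSpeed h κ m))) :
    0 < duffingPosition hf s := by
  have hl := hf.phase.strictMono hs.1
  have hr := hf.phase.strictMono hs.2
  have hql := hf.phase_int_mul_quarterPeriod (-1)
  have hqr := hf.phase_quarterPeriod
  simp only [Int.cast_neg, Int.cast_one, neg_mul, one_mul] at hql
  exact mul_pos (sqrt_pos.2 hm) (cos_pos_of_mem_Ioo ⟨by linarith, by linarith⟩)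

lemma countable_zeros_duffingPosition (hm : 0 < m) : {s | duffingPosition hf s = 0}.Countable := by
  have hcos : {w | cos w = 0}.Countable :=
    (countable_range fun k : ℤ => (2 * k + 1) * π / 2).mono fun w hw => by
      obtain ⟨k, rfl⟩ := cos_eq_zero_iff.1 hw
      exact ⟨k, rfl⟩
  simp only [duffingPosition_eq_zero_iff hf hm]
  exact hcos.preimage hf.phase.injective

end Duffing

lemma encard_zeros_cos (n : ℕ) :
    {w ∈ Ioo 0 (n * (π / 2)) | cos w = 0}.encard = (n / 2 : ℕ) := by
  have hpi := pi_div_two_pos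
  have himage : {w ∈ Ioo 0 (n * (π / 2)) | cos w = 0} =
      (fun j : ℕ => ((2 * j + 1 : ℕ) : ℝ) * (π / 2)) '' (Finset.range (n / 2)) := by
    ext w
    simp only [mem_ofPred_eq, mem_image, Finset.coe_range, mem_Iio, cos_eq_zero_iff]
    constructor
    · rintro ⟨⟨hpos, hlt⟩, m, rfl⟩
      rw [mul_div_assoc] at hpos hlt
      have hm : 0 < 2 * m + 1 := by exact_mod_cast pos_of_mul_pos_left hpos hpi.le
      have hmn : 2 * m + 1 < n := by exact_mod_cast lt_of_mul_lt_mul_right hlt hpi.le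
      lift m to ℕ using by lia
      exact ⟨m, by lia, by push_cast; ring⟩
    · rintro ⟨j, hj, rfl⟩
      refine ⟨⟨by positivity, ?_⟩, j, by push_cast; ring⟩
      exact mul_lt_mul_of_pos_right (by exact_mod_cast (by lia : 2 * j + 1 < n)) hpi
  rw [himage, InjOn.encard_image, encard_coe_eq_coe_finsetCard, Finset.card_range]
  intro i _ j _ hij
  have := Nat.cast_injective (mul_right_cancel₀ hpi.ne' hij)
  lia

section LeviCivita

lemma sqrt_sq_parabolic (b c : ℝ) :
    √(((b ^ 2 - c ^ 2) / 2) ^ 2 + (b * c) ^ 2) = (b ^ 2 + c ^ 2) / 2 := by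
  rw [show ((b ^ 2 - c ^ 2) / 2) ^ 2 + (b * c) ^ 2 = ((b ^ 2 + c ^ 2) / 2) ^ 2 by ring]
  exact sqrt_sq (by positivity)

lemma parabolic_ne_zero {b c : ℝ} (hbc : b ≠ 0 ∨ c ≠ 0) : (b ^ 2 - c ^ 2) / 2 ≠ 0 ∨ b * c ≠ 0 := by
  have hpos : 0 < (b ^ 2 + c ^ 2) / 2 := by rcases hbc with h | h <;> positivity
  by_contra! hzero
  simp [← sqrt_sq_parabolic, hzero] at hpos

variable {ξ η α β g : ℝ → ℝ} {h m n : ℝ} {I : Set ℝ}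

lemma IsDuffingSolution.velocity_sq_add_velocity_sq (hξ : IsDuffingSolution h 1 m ξ α)
    (hη : IsDuffingSolution h (-1) n η β) (henergy : n ^ 2 - m ^ 2 - 2 * h * (m + n) = 4) (s : ℝ) :
    α s ^ 2 + β s ^ 2 = 4 + 2 * h * (ξ s ^ 2 + η s ^ 2) + (ξ s ^ 4 - η s ^ 4) := by
  linear_combination hξ.energy s + hη.energy s + henergy

/-- Separation of the Stark problem in parabolic coordinates `x + i y = (ξ + i η) ^ 2 / 2`, with the
regularizing time `g t`, whose derivative is `1 / (2 √(x ^ 2 + y ^ 2))`. -/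
theorem isStarkSolutionOn_of_isDuffingSolution (hξ : IsDuffingSolution h 1 m ξ α)
    (hη : IsDuffingSolution h (-1) n η β) (henergy : n ^ 2 - m ^ 2 - 2 * h * (m + n) = 4)
    (hne : ∀ t ∈ I, ξ (g t) ≠ 0 ∨ η (g t) ≠ 0)
    (hg : ∀ t ∈ I, HasDerivAt g (ξ (g t) ^ 2 + η (g t) ^ 2)⁻¹ t) :
    IsStarkSolutionOn (fun t => (ξ (g t) ^ 2 - η (g t) ^ 2) / 2) (fun t => ξ (g t) * η (g t))
      (fun t => (ξ (g t) * α (g t) - η (g t) * β (g t)) / (ξ (g t) ^ 2 + η (g t) ^ 2))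
      (fun t => (α (g t) * η (g t) + ξ (g t) * β (g t)) / (ξ (g t) ^ 2 + η (g t) ^ 2)) I := by
  have hpos : ∀ t ∈ I, 0 < ξ (g t) ^ 2 + η (g t) ^ 2 := fun t ht => by
    rcases hne t ht with h | h <;> positivity
  have energy := hξ.velocity_sq_add_velocity_sq hη henergy
  have dξ : ∀ t ∈ I, HasDerivAt (fun t => ξ (g t)) _ t := fun t ht => (hξ.deriv _).comp t (hg t ht)
  have dη : ∀ t ∈ I, HasDerivAt (fun t => η (g t)) _ t := fun t ht => (hη.deriv _).comp t (hg t ht)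
  have dα : ∀ t ∈ I, HasDerivAt (fun t => α (g t)) _ t :=
    fun t ht => (hξ.deriv_velocity _).comp t (hg t ht)
  have dβ : ∀ t ∈ I, HasDerivAt (fun t => β (g t)) _ t :=
    fun t ht => (hη.deriv_velocity _).comp t (hg t ht)
  have dρ : ∀ t ∈ I, HasDerivAt (fun t => ξ (g t) ^ 2 + η (g t) ^ 2) _ t :=
    fun t ht => ((dξ t ht).pow 2).add ((dη t ht).pow 2)
  refine ⟨fun t ht => parabolic_ne_zero (hne t ht), fun t ht => ?_, fun t ht => ?_, fun t ht => ?_,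
    fun t ht => ?_⟩
  all_goals have hρ := (hpos t ht).ne'
  · refine ((((dξ t ht).pow 2).sub ((dη t ht).pow 2)).div_const 2).congr_deriv ?_
    field_simp
    ring
  · refine ((dξ t ht).mul (dη t ht)).congr_deriv ?_
    field_simp
  · refine ((((dξ t ht).mul (dα t ht)).sub ((dη t ht).mul (dβ t ht))).div (dρ t ht)
      hρ).congr_deriv ?_
    simp only [sqrt_sq_parabolic, Pi.sub_apply, Pi.mul_apply]
    field_simp
    linear_combination -(ξ (g t) ^ 2 - η (g t) ^ 2) * energy (g t)
  · refine ((((dα t ht).mul (dη t ht)).add ((dξ t ht).mul (dβ t ht))).div (dρ t ht)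
      hρ).congr_deriv ?_
    simp only [sqrt_sq_parabolic, Pi.add_apply, Pi.mul_apply]
    field_simp
    linear_combination -2 * ξ (g t) * η (g t) * energy (g t)

end LeviCivita

section OrbitFromRest

/-- The energy of the Stark problem at rest at a point of abscissa `a` at distance `r` from the
origin. -/
noncomputable def restEnergy (a r : ℝ) : ℝ := -(1 / r) - a

/-- The speed of the phase of the parabolic coordinate `ξ` of the solution starting at rest at a
point of abscissa `a` at distance `r` from the origin. -/
noncomputable abbrev speedXi (a r : ℝ) : ℝ → ℝ := duffingSpeed (restEnergy a r) 1 (r + a)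

/-- The speed of the phase of the parabolic coordinate `η` of the solution starting at rest at a
point of abscissa `a` at distance `r` from the origin. -/
noncomputable abbrev speedEta (a r : ℝ) : ℝ → ℝ := duffingSpeed (restEnergy a r) (-1) (r - a)

variable {a r : ℝ}

lemma add_pos_of_mem_Ioo_abs (hr : r ∈ Ioo |a| 1) : 0 < r + a := by
  linarith [hr.1, neg_abs_le a]

lemma sub_pos_of_mem_Ioo_abs (hr : r ∈ Ioo |a| 1) : 0 < r - a := by
  linarith [hr.1, le_abs_self a]

lemma one_lt_one_div_of_mem_Ioo_abs (hr : r ∈ Ioo |a| 1) : 1 < 1 / r :=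
  one_lt_one_div ((abs_nonneg a).trans_lt hr.1) hr.2

lemma restEnergy_neg (hr : r ∈ Ioo |a| 1) : restEnergy a r < 0 := by
  have := one_lt_one_div_of_mem_Ioo_abs hr
  rw [restEnergy]
  linarith [hr.1, hr.2, neg_abs_le a]

lemma isPhaseSpeed_speedXi (hr : r ∈ Ioo |a| 1) : IsPhaseSpeed (speedXi a r) :=
  isPhaseSpeed_duffingSpeed (restEnergy_neg hr) <| by
    rw [restEnergy]
    linarith [hr.2, one_lt_one_div_of_mem_Ioo_abs hr]

lemma isPhaseSpeed_speedEta (hr : r ∈ Ioo |a| 1) : IsPhaseSpeed (speedEta a r) :=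
  isPhaseSpeed_duffingSpeed (restEnergy_neg hr) <| by
    rw [restEnergy]
    linarith [hr.1, abs_nonneg a, one_lt_one_div_of_mem_Ioo_abs hr]

variable (hr : r ∈ Ioo |a| 1)

/-- The parabolic coordinate `ξ` of the orbit, in the regularizing time. -/
noncomputable abbrev xi : ℝ → ℝ := duffingPosition (isPhaseSpeed_speedXi hr)

/-- The parabolic coordinate `η` of the orbit, in the regularizing time. -/
noncomputable abbrev eta : ℝ → ℝ := duffingPosition (isPhaseSpeed_speedEta hr)

/-- The derivative of `xi` in the regularizing time. -/
noncomputable abbrev xiVelocity : ℝ → ℝ := duffingVelocity (isPhaseSpeed_speedXi hr)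

/-- The derivative of `eta` in the regularizing time. -/
noncomputable abbrev etaVelocity : ℝ → ℝ := duffingVelocity (isPhaseSpeed_speedEta hr)

lemma isDuffingSolution_xi :
    IsDuffingSolution (restEnergy a r) 1 (r + a) (xi hr) (xiVelocity hr) :=
  isDuffingSolution_duffingPosition _ (add_pos_of_mem_Ioo_abs hr).le

lemma isDuffingSolution_eta :
    IsDuffingSolution (restEnergy a r) (-1) (r - a) (eta hr) (etaVelocity hr) :=
  isDuffingSolution_duffingPosition _ (sub_pos_of_mem_Ioo_abs hr).le

lemma continuous_xi_sq_add_eta_sq : Continuous fun s => xi hr s ^ 2 + eta hr s ^ 2 :=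
  ((isDuffingSolution_xi hr).continuous.pow 2).add ((isDuffingSolution_eta hr).continuous.pow 2)

lemma dense_ne_zero_xi : Dense {s | xi hr s ≠ 0} :=
  (countable_zeros_duffingPosition _ (add_pos_of_mem_Ioo_abs hr)).dense_compl ℝ

lemma strictMono_primitive_xi_sq_add_eta_sq :
    StrictMono (primitive fun s => xi hr s ^ 2 + eta hr s ^ 2) :=
  strictMono_primitive (continuous_xi_sq_add_eta_sq hr) (fun s => by positivity)
    ((dense_ne_zero_xi hr).mono fun s (hs : xi hr s ≠ 0) => by
      have : 0 < xi hr s ^ 2 + eta hr s ^ 2 := by positivity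
      exact this.ne')

lemma surjective_primitive_xi_sq_add_eta_sq :
    Function.Surjective (primitive fun s => xi hr s ^ 2 + eta hr s ^ 2) := by
  have hcont : Continuous fun s => xi hr s ^ 2 := (isDuffingSolution_xi hr).continuous.pow 2
  have hperiod : 0 < 4 * quarterPeriod (speedXi a r) :=
    mul_pos four_pos (isPhaseSpeed_speedXi hr).quarterPeriod_pos
  refine surjective_primitive_of_periodic_le (continuous_xi_sq_add_eta_sq hr) hcont
    (fun s => le_add_of_nonneg_right (sq_nonneg _)) hperiod
    ((periodic_duffingPosition _).comp (· ^ 2)) ?_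
  have hmono := strictMono_primitive hcont (fun s => sq_nonneg _)
    ((dense_ne_zero_xi hr).mono fun s (hs : xi hr s ≠ 0) => pow_ne_zero 2 hs)
  simpa using hmono hperiod

/-- The physical time as a function of the regularizing time. -/
noncomputable def clock : ℝ ≃o ℝ :=
  (strictMono_primitive_xi_sq_add_eta_sq hr).orderIsoOfSurjective _
    (surjective_primitive_xi_sq_add_eta_sq hr)

lemma clock_apply (s : ℝ) : clock hr s = primitive (fun s => xi hr s ^ 2 + eta hr s ^ 2) s := rfl

@[simp]
lemma clock_zero : clock hr 0 = 0 := primitive_zero _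

@[simp]
lemma clock_symm_zero : (clock hr).symm 0 = 0 := by
  rw [OrderIso.symm_apply_eq, clock_zero]

lemma hasDerivAt_clock_symm {t : ℝ}
    (ht : xi hr ((clock hr).symm t) ≠ 0 ∨ eta hr ((clock hr).symm t) ≠ 0) :
    HasDerivAt (clock hr).symm
      (xi hr ((clock hr).symm t) ^ 2 + eta hr ((clock hr).symm t) ^ 2)⁻¹ t := by
  refine HasDerivAt.of_local_left_inverse (clock hr).symm.continuous.continuousAt
    (hasDerivAt_primitive (continuous_xi_sq_add_eta_sq hr) _) ?_
    (.of_forall (clock hr).apply_symm_apply)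
  have hpos : 0 < xi hr ((clock hr).symm t) ^ 2 + eta hr ((clock hr).symm t) ^ 2 := by
    rcases ht with h | h <;> positivity
  exact hpos.ne'

/-- The abscissa of the orbit starting at rest at `(a, √(r ^ 2 - a ^ 2))`. -/
noncomputable def orbitX (t : ℝ) : ℝ :=
  (xi hr ((clock hr).symm t) ^ 2 - eta hr ((clock hr).symm t) ^ 2) / 2

/-- The ordinate of the orbit starting at rest at `(a, √(r ^ 2 - a ^ 2))`. -/
noncomputable def orbitY (t : ℝ) : ℝ := xi hr ((clock hr).symm t) * eta hr ((clock hr).symm t)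

/-- The derivative of `orbitX` away from collisions. -/
noncomputable def orbitU (t : ℝ) : ℝ :=
  (xi hr ((clock hr).symm t) * xiVelocity hr ((clock hr).symm t) -
      eta hr ((clock hr).symm t) * etaVelocity hr ((clock hr).symm t)) /
    (xi hr ((clock hr).symm t) ^ 2 + eta hr ((clock hr).symm t) ^ 2)

/-- The derivative of `orbitY` away from collisions. -/
noncomputable def orbitV (t : ℝ) : ℝ :=
  (xiVelocity hr ((clock hr).symm t) * eta hr ((clock hr).symm t) +
      xi hr ((clock hr).symm t) * etaVelocity hr ((clock hr).symm t)) /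
    (xi hr ((clock hr).symm t) ^ 2 + eta hr ((clock hr).symm t) ^ 2)

lemma isStarkSolutionOn_orbit {I : Set ℝ}
    (hI : ∀ t ∈ I, xi hr ((clock hr).symm t) ≠ 0 ∨ eta hr ((clock hr).symm t) ≠ 0) :
    IsStarkSolutionOn (orbitX hr) (orbitY hr) (orbitU hr) (orbitV hr) I := by
  refine isStarkSolutionOn_of_isDuffingSolution (isDuffingSolution_xi hr)
    (isDuffingSolution_eta hr) ?_ hI fun t ht => hasDerivAt_clock_symm hr (hI t ht)
  have hr0 : r ≠ 0 := ((abs_nonneg a).trans_lt hr.1).ne'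
  rw [restEnergy]
  field_simp
  ring

lemma startsAtRest_orbit :
    StartsAtRest (orbitX hr) (orbitY hr) (orbitU hr) (orbitV hr) a √(r ^ 2 - a ^ 2) where
  x_zero := by
    simp only [orbitX, clock_symm_zero, duffingPosition_zero,
      sq_sqrt (add_pos_of_mem_Ioo_abs hr).le, sq_sqrt (sub_pos_of_mem_Ioo_abs hr).le]
    ring
  y_zero := by
    simp only [orbitY, clock_symm_zero, duffingPosition_zero,
      ← sqrt_mul (add_pos_of_mem_Ioo_abs hr).le, sq_sub_sq]
  u_zero := by simp [orbitU, duffingVelocity_zero]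
  v_zero := by simp [orbitV, duffingVelocity_zero]

lemma continuous_orbitX : Continuous (orbitX hr) :=
  ((((isDuffingSolution_xi hr).continuous.pow 2).sub
    ((isDuffingSolution_eta hr).continuous.pow 2)).div_const 2).comp (clock hr).symm.continuous

lemma continuous_orbitY : Continuous (orbitY hr) :=
  ((isDuffingSolution_xi hr).continuous.mul (isDuffingSolution_eta hr).continuous).comp
    (clock hr).symm.continuous

/-- The time of the first arrival on the closed negative `x`-axis. -/
noncomputable def arrivalTime : ℝ := clock hr (quarterPeriod (speedXi a r))

lemma arrivalTime_pos : 0 < arrivalTime hr := by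
  simpa [arrivalTime] using (clock hr).strictMono (isPhaseSpeed_speedXi hr).quarterPeriod_pos

lemma clock_symm_arrivalTime : (clock hr).symm (arrivalTime hr) = quarterPeriod (speedXi a r) :=
  (clock hr).symm_apply_apply _

lemma xi_quarterPeriod : xi hr (quarterPeriod (speedXi a r)) = 0 := by
  rw [duffingPosition_eq_zero_iff _ (add_pos_of_mem_Ioo_abs hr),
    (isPhaseSpeed_speedXi hr).phase_quarterPeriod, cos_pi_div_two]

lemma xi_clock_symm_pos {t : ℝ}
    (ht : t ∈ Ioo (clock hr (-quarterPeriod (speedXi a r))) (arrivalTime hr)) :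
    0 < xi hr ((clock hr).symm t) :=
  duffingPosition_pos _ (add_pos_of_mem_Ioo_abs hr)
    ⟨(clock hr).lt_symm_apply.2 ht.1, (clock hr).symm_apply_lt.2 ht.2⟩

lemma clock_neg_quarterPeriod_neg : clock hr (-quarterPeriod (speedXi a r)) < 0 := by
  simpa using (clock hr).strictMono (neg_neg_of_pos (isPhaseSpeed_speedXi hr).quarterPeriod_pos)

variable {hr} in
lemma orbitY_eq_zero_iff {t : ℝ} (ht : t ∈ Ioo 0 (arrivalTime hr)) :
    orbitY hr t = 0 ↔ eta hr ((clock hr).symm t) = 0 := by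
  have hxi := xi_clock_symm_pos hr ⟨(clock_neg_quarterPeriod_neg hr).trans ht.1, ht.2⟩
  rw [orbitY, mul_eq_zero, or_iff_right hxi.ne']

variable {hr} in
lemma orbitX_pos_of_orbitY_eq_zero {t : ℝ} (ht : t ∈ Ioo 0 (arrivalTime hr))
    (hy : orbitY hr t = 0) : 0 < orbitX hr t := by
  have hxi := xi_clock_symm_pos hr ⟨(clock_neg_quarterPeriod_neg hr).trans ht.1, ht.2⟩
  simpa [orbitX, (orbitY_eq_zero_iff ht).1 hy] using pow_pos hxi 2

section Resonance

variable {n : ℕ} (hres : quarterPeriod (speedXi a r) = n * quarterPeriod (speedEta a r))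
include hres

lemma phase_eta_int_mul_quarterPeriod_xi (m : ℤ) :
    (isPhaseSpeed_speedEta hr).phase (m * quarterPeriod (speedXi a r)) = (m * n : ℤ) * (π / 2) := by
  rw [hres, ← (isPhaseSpeed_speedEta hr).phase_int_mul_quarterPeriod, Int.cast_mul, mul_assoc,
    Int.cast_natCast]

lemma phase_eta_quarterPeriod_xi :
    (isPhaseSpeed_speedEta hr).phase (quarterPeriod (speedXi a r)) = n * (π / 2) := by
  have h := phase_eta_int_mul_quarterPeriod_xi hr hres 1
  rwa [Int.cast_one, one_mul, one_mul, Int.cast_natCast] at h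

lemma encard_positiveAxisTimes_orbit :
    (positiveAxisTimes (orbitX hr) (orbitY hr) (arrivalTime hr)).encard = (n / 2 : ℕ) := by
  obtain ⟨e, he⟩ : ∃ e : ℝ ≃o ℝ,
      ∀ t, e t = (isPhaseSpeed_speedEta hr).phase ((clock hr).symm t) :=
    ⟨(clock hr).symm.trans (isPhaseSpeed_speedEta hr).phase, fun _ => rfl⟩
  have h0 : e 0 = 0 := by rw [he, clock_symm_zero, IsPhaseSpeed.phase_zero]
  have hT : e (arrivalTime hr) = n * (π / 2) := by
    rw [he, clock_symm_arrivalTime, phase_eta_quarterPeriod_xi hr hres]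
  have hzero : ∀ t, eta hr ((clock hr).symm t) = 0 ↔ cos (e t) = 0 := fun t => by
    rw [he, duffingPosition_eq_zero_iff _ (sub_pos_of_mem_Ioo_abs hr)]
  have himage_Ioo : e '' Ioo 0 (arrivalTime hr) = Ioo 0 (n * (π / 2)) := by
    rw [e.image_Ioo, h0, hT]
  have himage : e '' positiveAxisTimes (orbitX hr) (orbitY hr) (arrivalTime hr) =
      {w ∈ Ioo 0 (n * (π / 2)) | cos w = 0} := by
    rw [← himage_Ioo]
    ext w
    simp only [positiveAxisTimes, mem_image, mem_ofPred_eq]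
    constructor
    · rintro ⟨t, ⟨ht, hy, -⟩, rfl⟩
      exact ⟨⟨t, ht, rfl⟩, (hzero t).1 ((orbitY_eq_zero_iff ht).1 hy)⟩
    · rintro ⟨⟨t, ht, rfl⟩, hw⟩
      have hy := (orbitY_eq_zero_iff ht).2 ((hzero t).2 hw)
      exact ⟨t, ⟨ht, hy, orbitX_pos_of_orbitY_eq_zero ht hy⟩, rfl⟩
  rw [← encard_zeros_cos, ← himage, e.injective.encard_image]

lemma exists_period_orbit :
    ∃ P > 0, Function.Periodic (orbitX hr) P ∧ Function.Periodic (orbitY hr) P := by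
  set q := quarterPeriod (speedXi a r)
  have hxi : Function.Periodic (xi hr) (4 * q) := periodic_duffingPosition _
  have heta : Function.Periodic (eta hr) (4 * q) := by
    rw [hres, mul_left_comm]
    exact (periodic_duffingPosition (isPhaseSpeed_speedEta hr)).nat_mul n
  have hclock : ∀ s, clock hr (s + 4 * q) = clock hr s + clock hr (4 * q) := fun s => by
    simpa [clock_apply] using primitive_add_int_mul (continuous_xi_sq_add_eta_sq hr)
      (P := 4 * q) (fun s => by rw [hxi, heta]) 1 s
  have hsymm : ∀ t, (clock hr).symm (t + clock hr (4 * q)) = (clock hr).symm t + 4 * q := by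
    intro t
    rw [OrderIso.symm_apply_eq, hclock, OrderIso.apply_symm_apply]
  refine ⟨clock hr (4 * q), ?_, fun t => ?_, fun t => ?_⟩
  · simpa using (clock hr).strictMono
      (mul_pos four_pos (isPhaseSpeed_speedXi hr).quarterPeriod_pos)
  · rw [orbitX, hsymm, hxi, heta, orbitX]
  · rw [orbitY, hsymm, hxi, heta, orbitY]

end Resonance

section EvenResonance

variable {k : ℕ} (hres : quarterPeriod (speedXi a r) = (2 * k : ℕ) * quarterPeriod (speedEta a r))
include hres

lemma sin_phase_eta_int_mul_quarterPeriod_xi (m : ℤ) :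
    sin ((isPhaseSpeed_speedEta hr).phase (m * quarterPeriod (speedXi a r))) = 0 := by
  rw [phase_eta_int_mul_quarterPeriod_xi hr hres, ← sin_int_mul_pi (m * k)]
  congr 1
  push_cast
  ring

lemma eta_int_mul_quarterPeriod_xi_ne_zero (m : ℤ) :
    eta hr (m * quarterPeriod (speedXi a r)) ≠ 0 := by
  rw [Ne, duffingPosition_eq_zero_iff _ (sub_pos_of_mem_Ioo_abs hr)]
  intro hcos
  simpa [hcos, sin_phase_eta_int_mul_quarterPeriod_xi hr hres m] using
    sin_sq_add_cos_sq ((isPhaseSpeed_speedEta hr).phase (m * quarterPeriod (speedXi a r)))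

lemma xi_ne_zero_or_eta_ne_zero (s : ℝ) : xi hr s ≠ 0 ∨ eta hr s ≠ 0 := by
  refine or_iff_not_imp_left.2 fun hxi => ?_
  rw [not_not, duffingPosition_eq_zero_iff _ (add_pos_of_mem_Ioo_abs hr), cos_eq_zero_iff] at hxi
  obtain ⟨m, hm⟩ := hxi
  have hs : s = (2 * m + 1 : ℤ) * quarterPeriod (speedXi a r) := by
    refine (isPhaseSpeed_speedXi hr).phase.injective ?_
    rw [hm, (isPhaseSpeed_speedXi hr).phase_int_mul_quarterPeriod]
    push_cast
    ring
  exact hs ▸ eta_int_mul_quarterPeriod_xi_ne_zero hr hres _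

lemma hitsNegativeAxisPerpendicularly_orbit :
    HitsNegativeAxisPerpendicularly (orbitX hr) (orbitY hr) (orbitU hr) (orbitV hr)
      (arrivalTime hr) := by
  have hxi := xi_quarterPeriod hr
  have hxiVelocity : xiVelocity hr (quarterPeriod (speedXi a r)) ≠ 0 := by
    rw [xiVelocity, duffingVelocity, (isPhaseSpeed_speedXi hr).phase_quarterPeriod, sin_pi_div_two,
      mul_one]
    exact neg_ne_zero.2 (mul_pos (sqrt_pos.2 (add_pos_of_mem_Ioo_abs hr))
      ((isPhaseSpeed_speedXi hr).pos _)).ne'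
  have heta : eta hr (quarterPeriod (speedXi a r)) ≠ 0 := by
    simpa using eta_int_mul_quarterPeriod_xi_ne_zero hr hres 1
  have hetaVelocity : etaVelocity hr (quarterPeriod (speedXi a r)) = 0 := by
    have hsin := sin_phase_eta_int_mul_quarterPeriod_xi hr hres 1
    rw [Int.cast_one, one_mul] at hsin
    simp [duffingVelocity, hsin]
  refine ⟨?_, ?_, ?_, ?_⟩
  · simp [orbitY, clock_symm_arrivalTime, hxi]
  · simp only [orbitX, clock_symm_arrivalTime, hxi]
    have : 0 < eta hr (quarterPeriod (speedXi a r)) ^ 2 := by positivity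
    linarith
  · simp [orbitU, clock_symm_arrivalTime, hxi, hetaVelocity]
  · simp [orbitV, clock_symm_arrivalTime, hxi, hxiVelocity, heta]

include hr in
theorem isTypeA_of_quarterPeriod_eq : IsTypeA a √(r ^ 2 - a ^ 2) k := by
  have hstart := startsAtRest_orbit hr
  obtain ⟨P, hP, hX, hY⟩ := exists_period_orbit hr hres
  refine ⟨orbitX hr, orbitY hr, orbitU hr, orbitV hr, hstart,
    ⟨isStarkSolutionOn_orbit hr fun t _ => xi_ne_zero_or_eta_ne_zero hr hres _,
      ⟨P, hP, hX, hY⟩, 0, hstart.u_zero, hstart.v_zero⟩,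
    arrivalTime hr, arrivalTime_pos hr, hitsNegativeAxisPerpendicularly_orbit hr hres,
    fun t ht => orbitX_pos_of_orbitY_eq_zero ht, ?_⟩
  rw [encard_positiveAxisTimes_orbit hr hres, Nat.mul_div_cancel_left k two_pos]

end EvenResonance

include hr in
theorem isTypeB_of_quarterPeriod_eq {k : ℕ}
    (hres : quarterPeriod (speedXi a r) = (2 * k + 1 : ℕ) * quarterPeriod (speedEta a r)) :
    IsTypeB a √(r ^ 2 - a ^ 2) k := by
  have heta : eta hr (quarterPeriod (speedXi a r)) = 0 := by
    rw [duffingPosition_eq_zero_iff _ (sub_pos_of_mem_Ioo_abs hr),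
      phase_eta_quarterPeriod_xi hr hres, cos_eq_zero_iff]
    exact ⟨k, by push_cast; ring⟩
  have hX : orbitX hr (arrivalTime hr) = 0 := by
    simp [orbitX, clock_symm_arrivalTime, xi_quarterPeriod, heta]
  have hY : orbitY hr (arrivalTime hr) = 0 := by
    simp [orbitY, clock_symm_arrivalTime, heta]
  refine ⟨orbitX hr, orbitY hr, orbitU hr, orbitV hr, startsAtRest_orbit hr,
    clock hr (-quarterPeriod (speedXi a r)), arrivalTime hr, clock_neg_quarterPeriod_neg hr,
    arrivalTime_pos hr, isStarkSolutionOn_orbit hr fun t ht => .inl (xi_clock_symm_pos hr ht).ne',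
    ?_, ?_, ?_⟩
  · exact hX ▸ ((continuous_orbitX hr).tendsto _).mono_left nhdsWithin_le_nhds
  · exact hY ▸ ((continuous_orbitY hr).tendsto _).mono_left nhdsWithin_le_nhds
  · rw [encard_positiveAxisTimes_orbit hr hres]
    congr 1
    lia

end OrbitFromRest

section LastCrossing

variable {f : ℝ → ℝ} {b c e : ℝ}

lemma exists_last_crossing (hce : c < e) (hf : ContinuousOn f (Ico c e))
    (hlim : Tendsto f (𝓝[<] e) atTop) {y : ℝ} (hy : f c ≤ y) :
    ∃ m ∈ Ico c e, f m = y ∧ ∀ t ∈ Ioo m e, y < f t := by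
  obtain ⟨l', hl', hgt⟩ :=
    (mem_nhdsLT_iff_exists_mem_Ico_Ioo_subset hce).1 (hlim.eventually_gt_atTop y)
  obtain ⟨l, hl'l, hle⟩ := exists_between hl'.2
  have hcl : c ≤ l := hl'.1.trans hl'l.le
  have hfl : ContinuousOn f (Icc c l) := hf.mono (Icc_subset_Ico_right hle)
  have hyl : y < f l := hgt ⟨hl'l, hle⟩
  have hcompact : IsCompact {t ∈ Icc c l | f t = y} :=
    isCompact_Icc.of_isClosed_subset (hfl.preimage_isClosed_of_isClosed isClosed_Icc
      isClosed_singleton) inter_subset_left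
  obtain ⟨m, ⟨hm, hfm⟩, hmax⟩ :=
    hcompact.exists_isGreatest (intermediate_value_Icc hcl hfl ⟨hy, hyl.le⟩)
  refine ⟨m, ⟨hm.1, hm.2.trans_lt hle⟩, hfm, fun t ht => ?_⟩
  by_contra! hty
  have htl : t ≤ l := le_of_not_gt fun h => hty.not_gt (hgt ⟨hl'l.trans h, ht.2⟩)
  have hct : c ≤ t := hm.1.trans ht.1.le
  obtain ⟨t', ht', hft'⟩ :=
    intermediate_value_Icc htl (hfl.mono (Icc_subset_Icc_left hct)) ⟨hty, hyl.le⟩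
  exact (ht.1.trans_le ht'.1).not_ge (hmax ⟨⟨hct.trans ht'.1, ht'.2⟩, hft'⟩)

lemma tendsto_right_endpoint_of_tendsto_comp_atTop {ι : Type*} {l : Filter ι} {s : ι → ℝ}
    (hf : ContinuousOn f (Ico c e)) (hs : ∀ᶠ i in l, s i ∈ Ico c e)
    (hfs : Tendsto (fun i => f (s i)) l atTop) : Tendsto s l (𝓝 e) := by
  refine tendsto_order.2 ⟨fun d hd => ?_, fun d hd => hs.mono fun i hi => hi.2.trans hd⟩
  obtain ⟨M, hM⟩ :=
    (isCompact_Icc.image_of_continuousOn (hf.mono (Icc_subset_Ico_right hd))).bddAbove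
  filter_upwards [hs, hfs.eventually_gt_atTop M] with i hi hMi
  by_contra! hle
  exact hMi.not_ge (hM (mem_image_of_mem f ⟨hi.1, hle⟩))

theorem exists_increasing_crossings (hbe : b < e) (hf : ContinuousOn f (Ioo b e))
    (hlim : Tendsto f (𝓝[<] e) atTop) :
    ∃ s : ℕ → ℝ, Tendsto s atTop (𝓝 e) ∧
      ∀ᶠ n : ℕ in atTop, s n ∈ Ioo b e ∧ f (s n) = n ∧ s n < s (n + 1) := by
  obtain ⟨c, hbc, hce⟩ := exists_between hbe
  have hfc : ContinuousOn f (Ico c e) := hf.mono fun t ht => ⟨hbc.trans_le ht.1, ht.2⟩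
  have hex : ∀ᶠ n : ℕ in atTop, ∃ m ∈ Ico c e, f m = n ∧ ∀ t ∈ Ioo m e, (n : ℝ) < f t :=
    (tendsto_natCast_atTop_atTop.eventually_ge_atTop (f c)).mono fun n hn =>
      exists_last_crossing hce hfc hlim hn
  obtain ⟨s, hs⟩ := hex.choice
  refine ⟨s, tendsto_right_endpoint_of_tendsto_comp_atTop hfc (hs.mono fun n hn => hn.1)
    (tendsto_natCast_atTop_atTop.congr' (hs.mono fun n hn => hn.2.1.symm)), ?_⟩
  filter_upwards [hs, (tendsto_add_atTop_nat 1).eventually hs] with n hn hn'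
  obtain ⟨hmem, hfn, _⟩ := hn
  obtain ⟨_, hfn', hlast⟩ := hn'
  refine ⟨⟨hbc.trans_le hmem.1, hmem.2⟩, hfn, lt_of_not_ge fun hle => ?_⟩
  have hle' : ((n + 1 : ℕ) : ℝ) ≤ n := by
    rcases hle.lt_or_eq with h | h
    · rw [← hfn]
      exact (hlast (s n) ⟨h, hmem.2⟩).le
    · rw [← hfn', h, hfn]
  exact Nat.not_succ_le_self n (Nat.cast_le.1 hle')

end LastCrossing

section QuarterPeriod

lemma IsPhaseSpeed.quarterPeriod_le {f : ℝ → ℝ} (hf : IsPhaseSpeed f) {c : ℝ} (hc : 0 < c)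
    (hle : ∀ w, c ≤ f w) : quarterPeriod f ≤ π / 2 * c⁻¹ := by
  have h := intervalIntegral.integral_mono_on pi_div_two_pos.le
    (hf.continuous_inv.intervalIntegrable 0 _)
    (continuous_const.intervalIntegrable (μ := MeasureTheory.volume) 0 _)
    fun w _ => inv_anti₀ hc (hle w)
  simpa [quarterPeriod, primitive] using h

lemma IsPhaseSpeed.log_le_quarterPeriod {f : ℝ → ℝ} (hf : IsPhaseSpeed f) {δ c : ℝ} (hδ : 0 < δ)
    (hc : 0 < c) (hle : ∀ w, 0 ≤ w → f w ≤ δ + c * w) :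
    c⁻¹ * log ((δ + c * (π / 2)) / δ) ≤ quarterPeriod f := by
  have hpos : ∀ w, 0 ≤ w → 0 < δ + c * w := fun w hw => by positivity
  have hcont : ContinuousOn (fun w => (δ + c * w)⁻¹) (uIcc 0 (π / 2)) := by
    rw [uIcc_of_le pi_div_two_pos.le]
    exact ContinuousOn.inv₀ (by fun_prop) fun w hw => (hpos w hw.1).ne'
  calc c⁻¹ * log ((δ + c * (π / 2)) / δ)
      = ∫ w in (0 : ℝ)..(π / 2), (δ + c * w)⁻¹ := by
        rw [intervalIntegral.integral_comp_add_mul (fun w => w⁻¹) hc.ne', mul_zero, add_zero,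
          integral_inv_of_pos hδ (hpos _ pi_div_two_pos.le), smul_eq_mul]
    _ ≤ quarterPeriod f :=
        intervalIntegral.integral_mono_on pi_div_two_pos.le hcont.intervalIntegrable
          (hf.continuous_inv.intervalIntegrable 0 _) fun w hw => inv_anti₀ (hf.pos w) (hle w hw.1)

lemma continuous_quarterPeriod_duffingSpeed {X : Type*} [TopologicalSpace X] {h m : X → ℝ} {κ : ℝ}
    (hh : Continuous h) (hm : Continuous m)
    (hf : ∀ x, IsPhaseSpeed (duffingSpeed (h x) κ (m x))) :
    Continuous fun x => quarterPeriod (duffingSpeed (h x) κ (m x)) := by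
  refine intervalIntegral.continuous_parametric_intervalIntegral_of_continuous'
    (f := fun x w => (duffingSpeed (h x) κ (m x) w)⁻¹)
    (Continuous.inv₀ ?_ fun p => ((hf p.1).pos p.2).ne') _ _
  unfold duffingSpeed
  fun_prop

variable {a r : ℝ}

lemma continuous_restEnergy_coe (a : ℝ) : Continuous fun r : Ioo |a| 1 => restEnergy a r :=
  ((continuous_const.div continuous_subtype_val
    fun r => ((abs_nonneg a).trans_lt r.2.1).ne').neg).sub continuous_const

lemma continuousOn_quarterPeriod_ratio (a : ℝ) :
    ContinuousOn (fun r => quarterPeriod (speedXi a r) / quarterPeriod (speedEta a r))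
      (Ioo |a| 1) := by
  rw [continuousOn_iff_continuous_domRestrict]
  exact (continuous_quarterPeriod_duffingSpeed (continuous_restEnergy_coe a) (by fun_prop)
      fun r => isPhaseSpeed_speedXi r.2).div
    (continuous_quarterPeriod_duffingSpeed (continuous_restEnergy_coe a) (by fun_prop)
      fun r => isPhaseSpeed_speedEta r.2) fun r => (isPhaseSpeed_speedEta r.2).quarterPeriod_pos.ne'

lemma quarterPeriod_speedEta_le (hr : r ∈ Ioo |a| 1) : quarterPeriod (speedEta a r) ≤ π / 2 := by
  have hle : ∀ w, 1 ≤ speedEta a r w := fun w => one_le_sqrt.2 <| by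
    have := mul_nonneg (sub_pos_of_mem_Ioo_abs hr).le (sq_nonneg (cos w))
    rw [restEnergy]
    linarith [one_lt_one_div_of_mem_Ioo_abs hr, add_pos_of_mem_Ioo_abs hr]
  simpa using (isPhaseSpeed_speedEta hr).quarterPeriod_le one_pos hle

lemma two_mul_one_div_sub_self_pos (hr : r ∈ Ioo |a| 1) : 0 < 2 * (1 / r - r) := by
  linarith [one_lt_one_div_of_mem_Ioo_abs hr, hr.2]

lemma speedXi_le (hr : r ∈ Ioo |a| 1) {w : ℝ} (hw : 0 ≤ w) :
    speedXi a r w ≤ √(2 * (1 / r - r)) + 2 * w := by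
  refine sqrt_le_iff.2 ⟨by positivity, ?_⟩
  have hsin : sin w ^ 2 ≤ w ^ 2 := sq_le_sq.2 abs_sin_le_abs
  have hmul : (r + a) * sin w ^ 2 ≤ 2 * w ^ 2 := by
    have := add_pos_of_mem_Ioo_abs hr
    gcongr
    linarith [hr.1, hr.2, le_abs_self a]
  have hcross : 0 ≤ 2 * √(2 * (1 / r - r)) * (2 * w) := by positivity
  calc -(2 * restEnergy a r + 1 * (r + a) * (1 + cos w ^ 2))
      = 2 * (1 / r - r) + (r + a) * sin w ^ 2 := by rw [restEnergy, cos_sq']; ring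
    _ ≤ √(2 * (1 / r - r)) ^ 2 + 2 * √(2 * (1 / r - r)) * (2 * w) + (2 * w) ^ 2 := by
        rw [sq_sqrt (two_mul_one_div_sub_self_pos hr).le]
        linarith [sq_nonneg w]
    _ = (√(2 * (1 / r - r)) + 2 * w) ^ 2 := (add_sq _ _).symm

lemma tendsto_quarterPeriod_speedXi (ha : |a| < 1) :
    Tendsto (fun r => quarterPeriod (speedXi a r)) (𝓝[<] 1) atTop := by
  have hmem : ∀ᶠ r in 𝓝[<] (1 : ℝ), r ∈ Ioo |a| 1 := Ioo_mem_nhdsLT ha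
  have hδpos : ∀ᶠ r in 𝓝[<] (1 : ℝ), 0 < √(2 * (1 / r - r)) :=
    hmem.mono fun r hr => sqrt_pos.2 (two_mul_one_div_sub_self_pos hr)
  have hδ : Tendsto (fun r : ℝ => √(2 * (1 / r - r))) (𝓝[<] 1) (𝓝[>] 0) := by
    have hcont : ContinuousAt (fun r : ℝ => √(2 * (1 / r - r))) 1 := by
      fun_prop (disch := norm_num)
    have h := hcont.tendsto.mono_left (nhdsWithin_le_nhds (s := Iio 1))
    norm_num only [sqrt_zero] at h
    exact tendsto_nhdsWithin_iff.2 ⟨by simpa using h, hδpos⟩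
  have hlog : Tendsto (fun r : ℝ => 2⁻¹ * log (√(2 * (1 / r - r)))⁻¹) (𝓝[<] 1) atTop :=
    (tendsto_log_atTop.comp (tendsto_inv_nhdsGT_zero.comp hδ)).const_mul_atTop (by norm_num)
  refine tendsto_atTop_mono' _ ?_ hlog
  filter_upwards [hmem, hδpos] with r hr hpos
  refine le_trans ?_ ((isPhaseSpeed_speedXi hr).log_le_quarterPeriod hpos two_pos
    fun w hw => speedXi_le hr hw)
  have hle : (√(2 * (1 / r - r)))⁻¹ ≤ (√(2 * (1 / r - r)) + 2 * (π / 2)) / √(2 * (1 / r - r)) := by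
    rw [inv_eq_one_div]
    exact div_le_div_of_nonneg_right (by linarith [pi_gt_three]) hpos.le
  gcongr

lemma tendsto_quarterPeriod_ratio (ha : |a| < 1) :
    Tendsto (fun r => quarterPeriod (speedXi a r) / quarterPeriod (speedEta a r)) (𝓝[<] 1)
      atTop := by
  refine tendsto_atTop_mono' _ ?_
    ((tendsto_quarterPeriod_speedXi ha).atTop_div_const pi_div_two_pos)
  filter_upwards [Ioo_mem_nhdsLT ha] with r hr
  exact div_le_div_of_nonneg_left (isPhaseSpeed_speedXi hr).quarterPeriod_pos.le
    (isPhaseSpeed_speedEta hr).quarterPeriod_pos (quarterPeriod_speedEta_le hr)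

theorem exists_isAdmissibleIndex (ha : |a| < 1) : ∃ kb, IsAdmissibleIndex a kb := by
  obtain ⟨s, hlim, hs⟩ := exists_increasing_crossings ha (continuousOn_quarterPeriod_ratio a)
    (tendsto_quarterPeriod_ratio ha)
  obtain ⟨N, hN⟩ := eventually_atTop.1 hs
  have hmem (n) (hn : N ≤ n) : s n ∈ Ioo |a| 1 := (hN n hn).1
  have hres (n) (hn : N ≤ n) :
      quarterPeriod (speedXi a (s n)) = n * quarterPeriod (speedEta a (s n)) :=
    (div_eq_iff (isPhaseSpeed_speedEta (hmem n hn)).quarterPeriod_pos.ne').1 (hN n hn).2.1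
  have hpos (n) (hn : N ≤ n) : 0 < √(s n ^ 2 - a ^ 2) :=
    sqrt_pos.2 <| sub_pos.2 <| sq_lt_sq.2 <| (hmem n hn).1.trans_le (le_abs_self _)
  have hlt (n) (hn : N ≤ n) : √(s n ^ 2 - a ^ 2) < √(s (n + 1) ^ 2 - a ^ 2) := by
    have hs0 : 0 ≤ s n := (abs_nonneg a).trans (hmem n hn).1.le
    have hsucc : s n < s (n + 1) := (hN n hn).2.2
    exact sqrt_lt_sqrt (sqrt_pos.1 (hpos n hn)).le (by gcongr)
  have htend : Tendsto (fun n => √(s n ^ 2 - a ^ 2)) atTop (𝓝 √(1 - a ^ 2)) := by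
    simpa using ((hlim.pow 2).sub_const (a ^ 2)).sqrt
  refine ⟨N, fun k => √(s (2 * k) ^ 2 - a ^ 2), fun k => √(s (2 * k + 1) ^ 2 - a ^ 2),
    fun k hk => ⟨hpos _ (by lia), ?_⟩, fun k hk => ⟨hpos _ (by lia), ?_⟩,
    htend.comp (tendsto_atTop_mono (fun k => ?_) tendsto_id),
    htend.comp (tendsto_atTop_mono (fun k => ?_) tendsto_id),
    fun k hk => ⟨hlt _ (by lia), hlt (2 * k + 1) (by lia)⟩⟩
  · exact isTypeA_of_quarterPeriod_eq (hmem _ (by lia)) (hres _ (by lia))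
  · exact isTypeB_of_quarterPeriod_eq (hmem _ (by lia)) (hres _ (by lia))
  · exact Nat.le_mul_of_pos_left k two_pos
  · exact (Nat.le_mul_of_pos_left k two_pos).trans (Nat.le_succ _)

end QuarterPeriod

section SturmComparison

variable {y v q : ℝ → ℝ} {s ω : ℝ}

lemma antitoneOn_wronskian_sin (hω : 0 < ω)
    (hy : ∀ t ∈ Icc s (s + π / ω), HasDerivAt y (v t) t)
    (hv : ∀ t ∈ Icc s (s + π / ω), HasDerivAt v (-(q t * y t)) t)
    (hq : ∀ t ∈ Icc s (s + π / ω), ω ^ 2 ≤ q t) (hpos : ∀ t ∈ Ioc s (s + π / ω), 0 < y t) :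
    AntitoneOn (fun t => v t * sin (ω * (t - s)) - y t * (ω * cos (ω * (t - s))))
      (Icc s (s + π / ω)) := by
  have hangle (t) : HasDerivAt (fun t => ω * (t - s)) ω t := by
    simpa using ((hasDerivAt_id t).sub_const s).const_mul ω
  have hderiv : ∀ t ∈ Icc s (s + π / ω),
      HasDerivAt (fun t => v t * sin (ω * (t - s)) - y t * (ω * cos (ω * (t - s))))
        (-((q t - ω ^ 2) * y t * sin (ω * (t - s)))) t := fun t ht =>
    (((hv t ht).mul (hangle t).sin).sub
      ((hy t ht).mul ((hangle t).cos.const_mul ω))).congr_deriv (by ring)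
  refine antitoneOn_of_hasDerivWithinAt_nonpos (convex_Icc _ _)
    (fun t ht => (hderiv t ht).continuousAt.continuousWithinAt)
    (fun t ht => (hderiv t (interior_subset ht)).hasDerivWithinAt) fun t ht => ?_
  rw [interior_Icc] at ht
  have hsin : 0 ≤ sin (ω * (t - s)) := by
    refine sin_nonneg_of_nonneg_of_le_pi (mul_nonneg hω.le (sub_nonneg.2 ht.1.le)) ?_
    rw [mul_comm, ← le_div_iff₀ hω]
    linarith [ht.2]
  exact neg_nonpos.2 <| mul_nonneg (mul_nonneg (sub_nonneg.2 (hq t (Ioo_subset_Icc_self ht)))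
    (hpos t (Ioo_subset_Ioc_self ht)).le) hsin

lemma not_forall_pos_of_sq_le (hω : 0 < ω)
    (hy : ∀ t ∈ Icc s (s + π / ω), HasDerivAt y (v t) t)
    (hv : ∀ t ∈ Icc s (s + π / ω), HasDerivAt v (-(q t * y t)) t)
    (hq : ∀ t ∈ Icc s (s + π / ω), ω ^ 2 ≤ q t) : ¬ ∀ t ∈ Ioc s (s + π / ω), 0 < y t := by
  intro hpos
  have hlt : s < s + π / ω := lt_add_of_pos_right s (div_pos pi_pos hω)
  have hleft : 0 ≤ y s := by
    refine ge_of_tendsto ((hy s (left_mem_Icc.2 hlt.le)).continuousAt.tendsto.mono_left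
      (nhdsWithin_le_nhds (s := Ioi s))) ?_
    filter_upwards [Ioc_mem_nhdsGT hlt] with t ht using (hpos t ht).le
  have hle := antitoneOn_wronskian_sin hω hy hv hq hpos (left_mem_Icc.2 hlt.le)
    (right_mem_Icc.2 hlt.le) hlt.le
  simp only [add_sub_cancel_left, mul_div_cancel₀ _ hω.ne', sin_pi, cos_pi, sub_self, mul_zero,
    sin_zero, cos_zero, mul_one, zero_sub, mul_neg, neg_neg] at hle
  have hright := mul_pos (hpos _ (right_mem_Ioc.2 hlt)) hω
  linarith [mul_nonneg hleft hω.le]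

theorem exists_zero_of_sq_le (hω : 0 < ω)
    (hy : ∀ t ∈ Icc s (s + π / ω), HasDerivAt y (v t) t)
    (hv : ∀ t ∈ Icc s (s + π / ω), HasDerivAt v (-(q t * y t)) t)
    (hq : ∀ t ∈ Icc s (s + π / ω), ω ^ 2 ≤ q t) : ∃ t ∈ Ioc s (s + π / ω), y t = 0 := by
  have hcont : ContinuousOn y (Ioc s (s + π / ω)) := fun t ht =>
    (hy t (Ioc_subset_Icc_self ht)).continuousAt.continuousWithinAt
  obtain ⟨t₁, ht₁, hle⟩ : ∃ t ∈ Ioc s (s + π / ω), y t ≤ 0 := by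
    simpa [and_assoc] using not_forall_pos_of_sq_le hω hy hv hq
  obtain ⟨t₂, ht₂, hge⟩ : ∃ t ∈ Ioc s (s + π / ω), 0 ≤ y t := by
    simpa [and_assoc] using not_forall_pos_of_sq_le hω (fun t ht => (hy t ht).neg)
      (fun t ht => (hv t ht).neg.congr_deriv (by rw [Pi.neg_apply, mul_neg])) hq
  exact isPreconnected_Ioc.intermediate_value ht₁ ht₂ hcont ⟨hle, hge⟩

end SturmComparison

section NearEquilibrium

lemma eventually_forall_mem_of_lipschitzOnWith {E : Type*} [NormedAddCommGroup E]
    [NormedSpace ℝ E] {V : E → E} {e : E} {K : NNReal} {s U : Set E}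
    (hV : LipschitzOnWith K V s) (hs : s ∈ 𝓝 e) (he : V e = 0) (hU : U ∈ 𝓝 e) (L : ℝ) :
    ∀ᶠ z₀ in 𝓝 e, ∀ z : ℝ → E, z 0 = z₀ → (∀ t ∈ Icc 0 L, HasDerivAt z (V (z t)) t) →
      ∀ t ∈ Icc 0 L, z t ∈ U := by
  obtain ⟨ε, hε, hball⟩ := Metric.nhds_basis_closedBall.mem_iff.1 (inter_mem hs hU)
  set δ : ℝ := ε / exp ((K + 1) * L)
  have hδ : 0 < δ := div_pos hε (exp_pos _)
  have hle {t : ℝ} (ht : t ≤ L) : δ * exp ((K + 1) * t) ≤ ε := by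
    rw [div_mul_eq_mul_div, div_le_iff₀ (exp_pos _)]
    gcongr
  filter_upwards [Metric.closedBall_mem_nhds e hδ] with z₀ hz₀ z hz0 hz t ht
  have hbound : ∀ t ∈ Icc 0 L, ‖z t - e‖ ≤ δ * exp ((K + 1) * t) := by
    refine image_norm_le_of_norm_deriv_right_lt_deriv_boundary (f' := fun t => V (z t))
      (B' := fun t => δ * (exp ((K + 1) * t) * (K + 1)))
      (fun t ht => ((hz t ht).sub_const e).continuousAt.continuousWithinAt)
      (fun t ht => ((hz t (Ico_subset_Icc_self ht)).sub_const e).hasDerivWithinAt) ?_ (fun t => ?_)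
      fun t ht heq => ?_
    · simpa [hz0, dist_eq_norm] using hz₀
    · simpa using (((hasDerivAt_id t).const_mul (K + 1 : ℝ)).exp).const_mul δ
    · have hmem : z t ∈ s := (hball (mem_closedBall_iff_norm.2 (heq.le.trans (hle ht.2.le)))).1
      calc ‖V (z t)‖ = ‖V (z t) - V e‖ := by rw [he, sub_zero]
        _ ≤ K * ‖z t - e‖ := hV.norm_sub_le hmem (mem_of_mem_nhds hs)
        _ < δ * (exp ((K + 1) * t) * (K + 1)) := by
          rw [heq]
          linarith [mul_pos hδ (exp_pos ((K + 1) * t))]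
  exact (hball (mem_closedBall_iff_norm.2 ((hbound t ht).trans (hle ht.2)))).2

lemma card_le_encard_of_pairwise_disjoint {ι α : Type*} [Fintype ι] {A : ι → Set α} {S : Set α}
    (hA : Pairwise (Function.onFun Disjoint A)) (hS : ∀ i, ∃ x ∈ A i, x ∈ S) :
    (Fintype.card ι : ℕ∞) ≤ S.encard := by
  choose f hfA hfS using hS
  have hinj : Function.Injective f := fun i j hij => by
    by_contra hne
    exact (hA hne).notMem_of_mem_left (hfA i) (hij ▸ hfA j)
  calc (Fintype.card ι : ℕ∞) = (range f).encard := by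
        rw [← image_univ, hinj.encard_image, encard_univ, ENat.card_eq_coe_fintype_card]
    _ ≤ S.encard := encard_le_encard (range_subset_iff.2 hfS)

variable {x y u v : ℝ → ℝ}

lemma le_encard_positiveAxisTimes {ω T : ℝ} {n : ℕ} (hsol : IsStarkSolutionOn x y u v univ)
    (hω : 0 < ω) (hT : n * (π / ω) < T)
    (hnear : ∀ t ∈ Icc 0 (n * (π / ω)), 0 < x t ∧ ω ^ 2 ≤ 1 / √(x t ^ 2 + y t ^ 2) ^ 3) :
    (n : ℕ∞) ≤ (positiveAxisTimes x y T).encard := by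
  have hdisj : Pairwise (Function.onFun Disjoint fun i : Fin n =>
      Ioc (((i : ℕ) : ℤ) • (π / ω)) ((((i : ℕ) : ℤ) + 1) • (π / ω))) :=
    (pairwise_disjoint_Ioc_zsmul (π / ω)).comp_of_injective
      (Nat.cast_injective.comp Fin.val_injective)
  rw [← Fintype.card_fin n]
  refine card_le_encard_of_pairwise_disjoint hdisj fun i => ?_
  have hstep : (((i : ℕ) : ℤ) + 1) • (π / ω) = ((i : ℕ) : ℤ) • (π / ω) + π / ω := by
    rw [add_zsmul, one_zsmul]
  have hstart : 0 ≤ ((i : ℕ) : ℤ) • (π / ω) := zsmul_nonneg (by positivity) (by positivity)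
  have hend : (((i : ℕ) : ℤ) + 1) • (π / ω) ≤ n * (π / ω) := by
    rw [zsmul_eq_mul]
    gcongr
    exact_mod_cast i.isLt
  rw [hstep] at hend ⊢
  have hsub {t : ℝ} (ht : t ∈ Icc (((i : ℕ) : ℤ) • (π / ω)) (((i : ℕ) : ℤ) • (π / ω) + π / ω)) :
      t ∈ Icc 0 (n * (π / ω)) := ⟨hstart.trans ht.1, ht.2.trans hend⟩
  obtain ⟨t, ht, hyt⟩ := exists_zero_of_sq_le hω (fun t _ => hsol.deriv_y t trivial)
    (fun t _ => (hsol.deriv_v t trivial).congr_deriv (by ring)) fun t ht => (hnear t (hsub ht)).2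
  exact ⟨t, ht, ⟨hstart.trans_lt ht.1, (ht.2.trans hend).trans_lt hT⟩, hyt,
    (hnear t (hsub (Ioc_subset_Icc_self ht))).1⟩

/-- The vector field of the Stark problem in the phase space with coordinates `(x, y, u, v)`. -/
noncomputable def starkField (z : ℝ × ℝ × ℝ × ℝ) : ℝ × ℝ × ℝ × ℝ :=
  (z.2.2.1, z.2.2.2, -(z.1 / √(z.1 ^ 2 + z.2.1 ^ 2) ^ 3) + 1,
    -(z.2.1 / √(z.1 ^ 2 + z.2.1 ^ 2) ^ 3))

lemma contDiffAt_starkField : ContDiffAt ℝ 1 starkField (1, 0, 0, 0) := by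
  unfold starkField
  fun_prop (disch := norm_num)

lemma eventually_not_isTypeA (k : ℕ) : ∀ᶠ p : ℝ × ℝ in 𝓝 (1, 0), ¬ IsTypeA p.1 p.2 k := by
  obtain ⟨K, s, hs, hK⟩ := contDiffAt_starkField.exists_lipschitzOnWith
  have hU : ∀ᶠ z : ℝ × ℝ × ℝ × ℝ in 𝓝 (1, 0, 0, 0),
      0 < z.1 ∧ (1 / 2) ^ 2 ≤ 1 / √(z.1 ^ 2 + z.2.1 ^ 2) ^ 3 := by
    have hcont : ContinuousAt (fun z : ℝ × ℝ × ℝ × ℝ => 1 / √(z.1 ^ 2 + z.2.1 ^ 2) ^ 3)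
        (1, 0, 0, 0) := by fun_prop (disch := norm_num)
    exact ((continuous_fst.tendsto' _ _ rfl).eventually_const_lt one_pos).and
      ((hcont.eventually_const_lt (by norm_num)).mono fun z hz => le_of_lt hz)
  have hnear := eventually_forall_mem_of_lipschitzOnWith hK hs (by simp [starkField]) hU
    ((k + 1 : ℕ) * (π / (1 / 2)))
  have hinit : Tendsto (fun p : ℝ × ℝ => (p.1, p.2, (0 : ℝ), (0 : ℝ))) (𝓝 (1, 0))
      (𝓝 (1, 0, 0, 0)) := Continuous.tendsto (by fun_prop) _
  filter_upwards [hinit.eventually hnear] with p hp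
  rintro ⟨x, y, u, v, hstart, hbrake, T, hT, hhit, -, hcard⟩
  have hsol := hbrake.solution
  have hmem := hp (fun t => (x t, y t, u t, v t))
    (by rw [hstart.x_zero, hstart.y_zero, hstart.u_zero, hstart.v_zero])
    fun t _ => (hsol.deriv_x t trivial).prodMk <| (hsol.deriv_y t trivial).prodMk <|
      (hsol.deriv_u t trivial).prodMk (hsol.deriv_v t trivial)
  have hlate : (k + 1 : ℕ) * (π / (1 / 2)) < T := by
    by_contra! hle
    exact hhit.2.1.not_gt (hmem T ⟨hT.le, hle⟩).1
  have hle := le_encard_positiveAxisTimes hsol one_half_pos hlate hmem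
  rw [hcard] at hle
  exact Nat.not_succ_le_self k (Nat.cast_le.1 hle)

theorem tendsto_admissibleIndex {kb : ℝ → ℕ}
    (hkb : ∀ a ∈ Ioo (-1 : ℝ) 1, IsAdmissibleIndex a (kb a)) : Tendsto kb (𝓝[<] 1) atTop := by
  refine tendsto_atTop.2 fun k => ?_
  have hfar : ∀ᶠ a in 𝓝 (1 : ℝ), ∀ d ∈ Icc 0 √(1 - a ^ 2), ¬ IsTypeA a d k := by
    have hev := eventually_not_isTypeA k
    rw [nhds_prod_eq, eventually_prod_iff] at hev
    obtain ⟨P, hP, Q, hQ, hPQ⟩ := hev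
    have hsqrt : Tendsto (fun a : ℝ => √(1 - a ^ 2)) (𝓝 1) (𝓝 0) :=
      Continuous.tendsto' (by fun_prop) _ _ (by norm_num)
    filter_upwards [hP, (tendsto_const_nhds.Icc hsqrt).eventually hQ.smallSets] with a ha hd d hmem
    exact hPQ ha (hd d hmem)
  filter_upwards [hfar.filter_mono nhdsWithin_le_nhds,
    Ioo_mem_nhdsLT (show (-1 : ℝ) < 1 by norm_num)] with a hnot ha
  by_contra! hlt
  obtain ⟨d, d', hA, -, hlim, -, hord⟩ := hkb a ha
  have hmono : MonotoneOn d (Ici k) := monotoneOn_nat_Ici_of_le_succ fun n hn =>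
    ((hord n (hlt.le.trans hn)).1.trans (hord n (hlt.le.trans hn)).2).le
  have hdle : d k ≤ √(1 - a ^ 2) := ge_of_tendsto hlim <|
    (eventually_ge_atTop k).mono fun n hn => hmono self_mem_Ici hn hn
  exact hnot (d k) ⟨(hA k hlt.le).1.le, hdle⟩ (hA k hlt.le).2

end NearEquilibrium

theorem theorem3 :
    (∀ a : ℝ, a ∈ Set.Ioo (-1 : ℝ) 1 → ∃ kb : ℕ, IsAdmissibleIndex a kb) ∧
    (∀ kb : ℝ → ℕ,
      (∀ a : ℝ, a ∈ Set.Ioo (-1 : ℝ) 1 → IsAdmissibleIndex a (kb a)) →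
        Filter.Tendsto kb (nhdsWithin 1 (Set.Iio 1)) Filter.atTop) :=
  ⟨fun _ ha => exists_isAdmissibleIndex (abs_lt.2 ha), fun _ hkb => tendsto_admissibleIndex hkb⟩
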